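/- Let $E$ be a finite-dimensional real inner product space and $T>0$. Let $A\subset E$ be a nonempty closed convex bounded set, let $a:[0,T]\to E$ be BV-continuous (continuous and of bounded variation), let $c:E\to E$ be Lipschitz with a constant $L_2<1$, and let $f:[0,T]\times E\to E$ satisfy the Carathéodory conditions with respect to Lebesgue measure ($t\mapsto f(t,x)$ is measurable for every $x$; $x\mapsto f(t,x)$ is continuous for almost every $t$; for every $R$ there is an integrable $m_R$ on $[0,T]$ such that for almost every $t$ one has $\|f(t,x)\|\le m_R(t)$ whenever $\|x\|\le R$) and be globally Lipschitz in $x$ with a constant independent of $t$. For a convex set $C\subset E$ put $N_C(x)=\{\xi\in E:\langle\xi,y-x\rangle\le 0\ \text{for all}\ y\in C\}$ if $x\in C$ and $N_C(x)=\emptyset$ if $x\notin C$. A BV-continuous function $x:[0,T]\to E$ is called a solution of the sweeping process $$-dx\in N_{A+a(t)+c(x)}(x)+f(t,x)\,dt \qquad (*)$$ if there is a finite Borel measure $\nu$ on $[0,T]$ such that both the differential (Stieltjes) measure $dx$ of $x$ and Lebesgue measure $dt$ are absolutely continuous with respect to $\nu$, and $$-\frac{dx}{d\nu}(t)\in N_{A+a(t)+c(x(t))}(x(t))+f(t,x(t))\,\frac{dt}{d\nu}(t)\quad\text{for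 $\nu$-almost every } t\in[0,T].$$ Theorem. For every $q\in E$ the equation $v=\mathrm{proj}(q,\,A+a(0)+c(v))$ (nearest-point projection) has exactly one solution $v=V(q)\in E$, and $(*)$ has a solution $x$ on $[0,T]$ with $x(0)=V(q)$. In particular, for every $q$ with $q\in A+a(0)+c(q)$, $(*)$ has a solution $x$ on $[0,T]$ with $x(0)=q$. -/

import Mathlib

open Set MeasureTheory
open scoped NNReal Pointwise

noncomputable section

namespace SweepingProcess

variable {E : Type*} [NormedAddCommGroup E] [InnerProductSpace ℝ E]

/-- The normal cone to `C` at `x`; it is empty when `x ∉ C`. -/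
def normalCone (C : Set E) (x : E) : Set E :=
  {ξ | x ∈ C ∧ ∀ y ∈ C, inner ℝ ξ (y - x) ≤ 0}

/-- `v` is a nearest point of `C` to `q`; for nonempty closed convex `C` in a finite-dimensional
space this says `v = proj(q, C)`. -/
def IsProj (q : E) (C : Set E) (v : E) : Prop :=
  v ∈ C ∧ ∀ w ∈ C, ‖q - v‖ ≤ ‖q - w‖

/-- The set `A + p + r`, used with `p = a(t)` and `r = c(x)`. -/
def movingSet (A : Set E) (p r : E) : Set E := A + {p} + {r}

/-- A BV-continuous function on `[0, T]`: continuous and of bounded variation. -/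
structure IsBVContinuous {T : ℝ} (x : Icc (0 : ℝ) T → E) : Prop where
  continuous : Continuous x
  boundedVariation : BoundedVariationOn x univ

/-- The differential (Stieltjes) measure `dx` of a BV-continuous function on `[0, T]`: the vector
measure on the Borel sets of `[0, T]` with `dx([s, t]) = x(t⁺) - x(s⁻)` and so on, where the
left limit at `0` and the right limit at `T` are `x(0)` and `x(T)`. -/
def differentialMeasure [FiniteDimensional ℝ E] {T : ℝ} {x : Icc (0 : ℝ) T → E}
    (hx : IsBVContinuous x) : VectorMeasure (Icc (0 : ℝ) T) E :=
  haveI : CompleteSpace E := FiniteDimensional.complete ℝ E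
  haveI : CompactIccSpace (Icc (0 : ℝ) T) := ⟨fun {_ _} => IsClosed.isCompact isClosed_Icc⟩
  hx.boundedVariation.vectorMeasure

/-- `g` is a Radon-Nikodym derivative (density) of the vector measure `m` with respect to `ν`. -/
structure IsDensity {X : Type*} [MeasurableSpace X] (m : VectorMeasure X E) (ν : Measure X)
    (g : X → E) : Prop where
  integrable : Integrable g ν
  eq_setIntegral : ∀ D, MeasurableSet D → m D = ∫ t in D, g t ∂ν

/-- Lebesgue measure `dt` on `[0, T]`. -/
def lebesgue (T : ℝ) : Measure (Icc (0 : ℝ) T) := Measure.comap Subtype.val volume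

/-- The Caratheodory conditions on `[0, T] × E` with respect to Lebesgue measure. -/
structure IsCaratheodory {T : ℝ} (f : Icc (0 : ℝ) T → E → E) : Prop where
  measurable : ∀ x, AEStronglyMeasurable (fun t => f t x) (lebesgue T)
  continuous : ∀ᵐ t ∂(lebesgue T), Continuous (f t)
  locally_bounded : ∀ R : ℝ, ∃ m : Icc (0 : ℝ) T → ℝ, Integrable m (lebesgue T) ∧
    ∀ᵐ t ∂(lebesgue T), ∀ x, ‖x‖ ≤ R → ‖f t x‖ ≤ m t

/-- `x` is a solution on `[0, T]` of `-dx ∈ N_{A + a(t) + c(x)}(x) + f(t, x) dt`: it is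
BV-continuous, and there is a finite measure `ν` on `[0, T]` such that `dx` and Lebesgue measure
`dt` are `ν`-continuous and
`-(dx/dν)(t) ∈ N_{A + a(t) + c(x(t))}(x(t)) + f(t, x(t)) (dt/dν)(t)` for `ν`-almost all `t`. -/
def IsSolution [FiniteDimensional ℝ E] {T : ℝ} (A : Set E) (a : Icc (0 : ℝ) T → E) (c : E → E)
    (f : Icc (0 : ℝ) T → E → E) (x : Icc (0 : ℝ) T → E) : Prop :=
  ∃ hx : IsBVContinuous x, ∃ ν : Measure (Icc (0 : ℝ) T), IsFiniteMeasure ν ∧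
    VectorMeasure.AbsolutelyContinuous (differentialMeasure hx) ν.toENNRealVectorMeasure ∧
    Measure.AbsolutelyContinuous (lebesgue T) ν ∧
    ∃ g : Icc (0 : ℝ) T → E, IsDensity (differentialMeasure hx) ν g ∧
      ∀ᵐ t ∂ν, -(g t) ∈ normalCone (movingSet A (a t) (c (x t))) (x t) +
        {(Measure.rnDeriv (lebesgue T) ν t).toReal • f t (x t)}

end SweepingProcess

end

namespace SweepingProcess

open Filter Topology

/-! ### Projection onto a translate that depends on the projected point -/

section Projection

/-! The moving set is a translate of the fixed set `A`. With z = x - a - c(x), the differential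
inclusion says that z(t) ∈ A and ⟨α - z(t), dx/dν + f(t, x) dt/dν⟩ ≥ 0 for all α ∈ A.

Approximate trajectories come from a catching-up scheme. Each step subtracts the integral of f at
the frozen current state and projects onto the set translated by c of the new state; this implicit
equation is solved by a contraction (`existsUnique_isProj`). One finite atomless measure ν,
dominating dt, the variation of a and ‖f(·, 0)‖ dt (`exists_control_measure`), governs all
estimates: the iterates stay in a ball since `A` is bounded and L < 1, and each step is at most a
constant times the ν-mass of its time interval. Compactness then gives a uniform limit x whose
increments are dominated by a multiple of ν.

Passing to the limit in a product of z with dx is avoided by testing against a constant ζ. If ‖z -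
ζ‖ ≤ ω on [s, t], the discrete inequalities sum to ⟨α - ζ, x(t) - x(s) + ∫ f⟩ ≥ -Kω ν((s, t]) up to
vanishing errors (`inner_sum_ge`), and this survives the limit (`exists_integrated_solution`).
Lebesgue differentiation with respect to ν, taking ζ = z(t), then makes the error disappear
(`ae_inner_nonneg`). -/

lemma mem_movingSet {E : Type*} [NormedAddCommGroup E] {A : Set E} {p r v : E} :
    v ∈ movingSet A p r ↔ v - p - r ∈ A := by
  simp only [movingSet, Set.add_singleton, Set.mem_image]
  constructor
  · rintro ⟨w, ⟨α, hα, rfl⟩, rfl⟩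
    rwa [show α + p + r - p - r = α by abel]
  · intro h
    exact ⟨v - r, ⟨v - p - r, h, by abel⟩, by abel⟩

variable {E : Type*} [NormedAddCommGroup E] [InnerProductSpace ℝ E]

/-- The variational characterization of the nearest-point projection onto `A + p + r`. -/
lemma isProj_movingSet_iff {A : Set E} (hA : Convex ℝ A) {p r q v : E} :
    IsProj q (movingSet A p r) v ↔
      v - p - r ∈ A ∧ ∀ α ∈ A, inner ℝ (q - v) (α - (v - p - r)) ≤ 0 := by
  unfold IsProj
  simp only [mem_movingSet]
  refine and_congr_right fun hv => ?_
  have hd : ∀ α : E, q - (α + p + r) = (q - v) - (α - (v - p - r)) := fun α => by abel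
  constructor
  · intro h α hα
    by_contra! hpos
    set w := α - (v - p - r) with hw
    set i := inner ℝ (q - v) w with hi
    have key : ∀ θ : ℝ, 0 < θ → θ ≤ 1 → 2 * i ≤ θ * ‖w‖ ^ 2 := by
      intro θ h0 h1
      have hmem : v - p - r + θ • w ∈ A := by
        have := hA hv hα (a := 1 - θ) (b := θ) (by linarith) h0.le (by ring)
        convert this using 1
        rw [hw]; module
      have h2 := h (v - p - r + θ • w + p + r)
          (by rwa [show v - p - r + θ • w + p + r - p - r = v - p - r + θ • w by abel])
      rw [hd, show v - p - r + θ • w - (v - p - r) = θ • w by abel] at h2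
      have h3 := pow_le_pow_left₀ (norm_nonneg _) h2 2
      rw [norm_sub_sq_real (q - v) (θ • w), inner_smul_right, norm_smul, mul_pow,
        Real.norm_eq_abs, sq_abs, ← hi] at h3
      have h4 : θ * (2 * i) ≤ θ * (θ * ‖w‖ ^ 2) := by nlinarith
      exact le_of_mul_le_mul_left h4 h0
    have hw2 : 0 ≤ ‖w‖ ^ 2 := sq_nonneg _
    -- This θ lies in (0, 1] even if w = 0, and θ‖w‖² ≤ i, so `key` yields 2i ≤ i, against i > 0.
    have h5 := key (i / (i + ‖w‖ ^ 2)) (by positivity) ((div_le_one (by positivity)).2 (by linarith))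
    have h6 : i / (i + ‖w‖ ^ 2) * ‖w‖ ^ 2 ≤ i := by
      rw [div_mul_eq_mul_div, div_le_iff₀ (by positivity)]
      nlinarith
    linarith
  · intro h w hw
    have h1 := h _ hw
    have h2 : q - w = (q - v) - (w - p - r - (v - p - r)) := by abel
    have h3 : ‖q - v‖ ^ 2 ≤ ‖q - w‖ ^ 2 := by
      rw [h2, norm_sub_sq_real (q - v)]
      nlinarith [sq_nonneg ‖w - p - r - (v - p - r)‖]
    exact le_of_sq_le_sq h3 (norm_nonneg _)

/-- The implicit projection equation `v = proj(q, A + p + c(v))` has exactly one solution. -/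
lemma existsUnique_isProj [CompleteSpace E] {A : Set E} (hne : A.Nonempty) (hcl : IsClosed A)
    (hA : Convex ℝ A) {c : E → E} {L : ℝ≥0} (hL : L < 1) (hc : LipschitzWith L c) (p q : E) :
    ∃! v, IsProj q (movingSet A p (c v)) v := by
  have hP : ∀ u : E, ∃ w ∈ A, ∀ α ∈ A, inner ℝ (u - w) (α - w) ≤ 0 := by
    intro u
    obtain ⟨w, hw, h⟩ := exists_norm_eq_iInf_of_complete_convex hne hcl.isComplete hA u
    exact ⟨w, hw, (norm_eq_iInf_iff_real_inner_le_zero hA hw).1 h⟩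
  choose P hPA hP using hP
  -- The residual id - P is nonexpansive, by adding the two variational inequalities.
  have hres : ∀ u u' : E, ‖(u - P u) - (u' - P u')‖ ≤ ‖u - u'‖ := by
    intro u u'
    have h1 := hP u (P u') (hPA u')
    have h2 := hP u' (P u) (hPA u)
    set d := (u - P u) - (u' - P u') with hd
    have h3 : inner ℝ d (P u - P u') ≥ 0 := by
      have e : inner ℝ d (P u - P u') = -inner ℝ (u - P u) (P u' - P u)
          - inner ℝ (u' - P u') (P u - P u') := by
        rw [hd, inner_sub_left, ← inner_neg_right, neg_sub]
      rw [e]; linarith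
    have h4 : u - u' = d + (P u - P u') := by rw [hd]; abel
    have h5 : ‖d‖ ^ 2 ≤ ‖u - u'‖ ^ 2 := by
      rw [h4, norm_add_sq_real]
      nlinarith [sq_nonneg ‖P u - P u'‖]
    exact le_of_sq_le_sq h5 (norm_nonneg _)
  -- The equation reads v = p + c(v) + P(q - p - c(v)). Writing it through the residual gives
  -- Lipschitz constant L; bounding the two terms separately would only give 2L.
  let Φ : E → E := fun v => q - ((q - p - c v) - P (q - p - c v))
  have hΦ : ContractingWith L Φ := by
    refine ⟨hL, LipschitzWith.of_dist_le_mul fun v v' => ?_⟩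
    rw [dist_eq_norm, dist_eq_norm]
    calc ‖Φ v - Φ v'‖ = ‖((q - p - c v') - P (q - p - c v')) - ((q - p - c v) - P (q - p - c v))‖ := by
          congr 1; simp only [Φ]; abel
      _ ≤ ‖(q - p - c v') - (q - p - c v)‖ := hres _ _
      _ = ‖c v - c v'‖ := by congr 1; abel
      _ ≤ L * ‖v - v'‖ := hc.norm_sub_le v v'
  have hiff : ∀ v, IsProj q (movingSet A p (c v)) v ↔ Φ v = v := by
    intro v
    rw [isProj_movingSet_iff hA]
    constructor
    · rintro ⟨hv, h⟩
      have h1 := h _ (hPA (q - p - c v))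
      have h2 := hP (q - p - c v) _ hv
      have h3 : P (q - p - c v) = v - p - c v := by
        rw [← sub_eq_zero, ← norm_eq_zero, ← sq_eq_zero_iff]
        refine le_antisymm ?_ (sq_nonneg _)
        rw [← real_inner_self_eq_norm_sq]
        have e : inner ℝ (P (q - p - c v) - (v - p - c v)) (P (q - p - c v) - (v - p - c v))
            = inner ℝ (q - v) (P (q - p - c v) - (v - p - c v))
              + inner ℝ (q - p - c v - P (q - p - c v)) (v - p - c v - P (q - p - c v)) := by
          rw [← neg_sub (P (q - p - c v)) (v - p - c v), inner_neg_right, ← sub_eq_add_neg,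
            ← inner_sub_left]
          congr 1; abel
        rw [e]; linarith
      simp only [Φ, h3]; abel
    · intro h
      have h3 : v - p - c v = P (q - p - c v) := by
        rw [← sub_eq_zero] at h ⊢
        rw [show v - p - c v - P (q - p - c v) = -(Φ v - v) by simp only [Φ]; abel, h, neg_zero]
      rw [h3]
      refine ⟨hPA _, fun α hα => ?_⟩
      have := hP (q - p - c v) α hα
      rwa [← h3, show q - p - c v - (v - p - c v) = q - v by abel, h3] at this
  simp only [hiff]
  exact ⟨hΦ.fixedPoint, hΦ.fixedPoint_isFixedPt, fun y hy => hΦ.fixedPoint_unique hy⟩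

end Projection

/-! ### The discrete scheme and its a priori estimates -/

section Scheme

variable {E : Type*} [NormedAddCommGroup E]

/-- Since ‖v‖ ≤ M + Ma + ‖c(0)‖ + L‖v‖, the last term is absorbed on the left. The bound does not
depend on the time step. -/
lemma norm_le_of_mem_movingSet {A : Set E} {c : E → E} {L : ℝ≥0} (hL : L < 1)
    (hc : LipschitzWith L c) {M : ℝ} (hM : ∀ α ∈ A, ‖α‖ ≤ M) {p v : E} {Ma : ℝ} (hp : ‖p‖ ≤ Ma)
    (hv : v - p - c v ∈ A) : ‖v‖ ≤ (M + Ma + ‖c 0‖) / (1 - L) := by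
  have hL' : (0 : ℝ) < 1 - L := by
    have : (L : ℝ) < 1 := by exact_mod_cast hL
    linarith
  rw [le_div_iff₀ hL']
  have h1 := hM _ hv
  have h2 : ‖c v - c 0‖ ≤ L * ‖v - 0‖ := hc.norm_sub_le v 0
  rw [sub_zero] at h2
  have h3 : ‖v‖ ≤ ‖v - p - c v‖ + ‖p‖ + (‖c v - c 0‖ + ‖c 0‖) := by
    calc ‖v‖ = ‖(v - p - c v) + p + ((c v - c 0) + c 0)‖ := by congr 1; abel
      _ ≤ _ := (norm_add_le _ _).trans (add_le_add (norm_add_le _ _) (norm_add_le _ _))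
  nlinarith

/-- One step of the implicit catching-up scheme moves the state by a controlled amount. -/
lemma norm_step_le {A : Set E} {c : E → E} {L : ℝ≥0} (hL : L < 1)
    (hc : LipschitzWith L c) {p p' u v F : E} (hu : u - p - c u ∈ A)
    (hv : IsProj (u - F) (movingSet A p' (c v)) v) :
    ‖v - u‖ ≤ (2 * ‖F‖ + ‖p' - p‖) / (1 - L) := by
  have hL' : (0 : ℝ) < 1 - L := by
    have : (L : ℝ) < 1 := by exact_mod_cast hL
    linarith
  rw [le_div_iff₀ hL']
  -- The competitor carries the point of `A` underlying u along with the translation.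
  have h1 := hv.2 (u - p - c u + p' + c v) (by
    rw [mem_movingSet]
    rwa [show u - p - c u + p' + c v - p' - c v = u - p - c u by abel])
  have h2 : ‖c v - c u‖ ≤ L * ‖v - u‖ := hc.norm_sub_le v u
  have h3 : ‖u - F - (u - p - c u + p' + c v)‖ ≤ ‖F‖ + ‖p' - p‖ + ‖c v - c u‖ := by
    calc _ = ‖-(F + (p' - p) + (c v - c u))‖ := by congr 1; abel
      _ ≤ _ := by
        rw [norm_neg]
        exact norm_add₃_le
  have h4 : ‖v - u‖ ≤ ‖u - F - v‖ + ‖F‖ := by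
    calc ‖v - u‖ = ‖-((u - F - v) + F)‖ := by congr 1; abel
      _ ≤ _ := by rw [norm_neg]; exact norm_add_le _ _
  nlinarith

lemma norm_sub_le_of_step_le {X : ℕ → E} {w : ℕ → ℝ} {K : ℝ}
    (h : ∀ i, ‖X (i + 1) - X i‖ ≤ K * (w (i + 1) - w i)) {j k : ℕ} (hjk : j ≤ k) :
    ‖X k - X j‖ ≤ K * (w k - w j) := by
  induction k, hjk using Nat.le_induction with
  | base => simp
  | succ k hk ih =>
    calc ‖X (k + 1) - X j‖ ≤ ‖X (k + 1) - X k‖ + ‖X k - X j‖ := norm_sub_le_norm_sub_add_norm_sub _ _ _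
      _ ≤ K * (w (k + 1) - w k) + K * (w k - w j) := add_le_add (h k) ih
      _ = _ := by ring

variable [InnerProductSpace ℝ E]

/-- The implicit catching-up scheme along an arbitrary sequence of data. -/
lemma exists_catchingUp [CompleteSpace E] {A : Set E} (hne : A.Nonempty) (hcl : IsClosed A)
    (hA : Convex ℝ A) {c : E → E} {L : ℝ≥0} (hL : L < 1) (hc : LipschitzWith L c)
    {M Ma B : ℝ} (hM : ∀ α ∈ A, ‖α‖ ≤ M) (p : ℕ → E) (hp : ∀ i, ‖p i‖ ≤ Ma)
    (w : ℕ → ℝ) (hpw : ∀ i, ‖p (i + 1) - p i‖ ≤ w (i + 1) - w i) (F : ℕ → E → E)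
    (hF : ∀ i x, ‖x‖ ≤ (M + Ma + ‖c 0‖) / (1 - L) → ‖F i x‖ ≤ B * (w (i + 1) - w i))
    {x₀ : E} (hx₀ : x₀ - p 0 - c x₀ ∈ A) :
    ∃ X : ℕ → E, X 0 = x₀ ∧ (∀ i, X i - p i - c (X i) ∈ A) ∧
      (∀ i, ‖X i‖ ≤ (M + Ma + ‖c 0‖) / (1 - L)) ∧
      (∀ i, ‖X (i + 1) - X i‖ ≤ (2 * B + 1) / (1 - L) * (w (i + 1) - w i)) ∧
      ∀ i, ∀ α ∈ A, 0 ≤ inner ℝ (α - (X (i + 1) - p (i + 1) - c (X (i + 1))))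
        (X (i + 1) - X i + F i (X i)) := by
  have hL' : (0 : ℝ) < 1 - L := by
    have : (L : ℝ) < 1 := by exact_mod_cast hL
    linarith
  choose V hV _ using fun p q => existsUnique_isProj hne hcl hA hL hc p q
  let X : ℕ → E := fun i => Nat.rec x₀ (fun i x => V (p (i + 1)) (x - F i x)) i
  have hX : ∀ i, IsProj (X i - F i (X i)) (movingSet A (p (i + 1)) (c (X (i + 1)))) (X (i + 1)) :=
    fun i => hV _ _
  have hXA : ∀ i, X i - p i - c (X i) ∈ A := by
    intro i
    cases i with
    | zero => exact hx₀
    | succ i => exact mem_movingSet.1 (hX i).1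
  have hXR : ∀ i, ‖X i‖ ≤ (M + Ma + ‖c 0‖) / (1 - L) := fun i =>
    norm_le_of_mem_movingSet hL hc hM (hp i) (hXA i)
  refine ⟨X, rfl, hXA, hXR, fun i => ?_, fun i α hα => ?_⟩
  · refine (norm_step_le hL hc (hXA i) (hX i)).trans ?_
    rw [div_mul_eq_mul_div]
    gcongr
    nlinarith [hF i _ (hXR i), hpw i]
  · have h1 := ((isProj_movingSet_iff hA).1 (hX i)).2 α hα
    have h2 : X (i + 1) - X i + F i (X i) = -(X i - F i (X i) - X (i + 1)) := by abel
    rw [h2, inner_neg_right, real_inner_comm]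
    linarith

/-- Summation of the discrete variational inequalities against a fixed test vector. -/
lemma inner_sum_ge {X z F Y : ℕ → E} {w : ℕ → ℝ} {α ζ : E} {K B ω δ : ℝ} (hω : 0 ≤ ω)
    (hX : ∀ i, ‖X (i + 1) - X i‖ ≤ K * (w (i + 1) - w i))
    (hF : ∀ i, ‖F i‖ ≤ B * (w (i + 1) - w i))
    (hvar : ∀ i, 0 ≤ inner ℝ (α - z (i + 1)) (X (i + 1) - X i + F i))
    {j k : ℕ} (hjk : j ≤ k)
    (hz : ∀ i, j < i → i ≤ k → ‖z i - ζ‖ ≤ ω)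
    (hY : ∀ i, j ≤ i → i < k → ‖F i - (Y (i + 1) - Y i)‖ ≤ δ * (w (i + 1) - w i)) :
    -((ω * (K + B) + ‖α - ζ‖ * δ) * (w k - w j)) ≤ inner ℝ (α - ζ) (X k - X j + (Y k - Y j)) := by
  induction k, hjk using Nat.le_induction with
  | base => simp
  | succ k hk ih =>
    have ih' := ih (fun i h1 h2 => hz i h1 (h2.trans k.le_succ))
      (fun i h1 h2 => hY i h1 (h2.trans k.lt_succ_self))
    set D := X (k + 1) - X k + F k
    set G := F k - (Y (k + 1) - Y k)
    have e : X (k + 1) - X j + (Y (k + 1) - Y j) = (X k - X j + (Y k - Y j)) + (D - G) := by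
      simp only [D, G]; abel
    -- The first term is nonnegative by the scheme, the second costs ω for freezing z at ζ, and the
    -- third costs δ for replacing F by the increment of Y.
    have e2 : inner ℝ (α - ζ) (D - G) = inner ℝ (α - z (k + 1)) D
        + inner ℝ (z (k + 1) - ζ) D - inner ℝ (α - ζ) G := by
      rw [inner_sub_right, ← inner_add_left, sub_add_sub_cancel]
    have h1 : |inner ℝ (z (k + 1) - ζ) D| ≤ ω * ((K + B) * (w (k + 1) - w k)) := by
      refine (abs_real_inner_le_norm _ _).trans ?_
      refine mul_le_mul (hz _ (by omega) le_rfl) ?_ (norm_nonneg _) hω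
      refine (norm_add_le _ _).trans ?_
      linarith [hX k, hF k]
    have h2 : |inner ℝ (α - ζ) G| ≤ ‖α - ζ‖ * (δ * (w (k + 1) - w k)) :=
      (abs_real_inner_le_norm _ _).trans
        (mul_le_mul_of_nonneg_left (hY k hk k.lt_succ_self) (norm_nonneg _))
    rw [e, inner_add_right, e2]
    have h3 := hvar k
    have h4 := neg_le_of_abs_le h1
    have h5 := le_of_abs_le h2
    linarith

end Scheme

/-! ### Uniform partitions -/

section Grid

variable {T : ℝ}

/-- A fine partition of `[0, T]` along which a given continuous function varies little. -/
lemma exists_grid (hT : 0 < T) {v : Icc (0 : ℝ) T → ℝ} (hv : Continuous v) {ε : ℝ} (hε : 0 < ε) :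
    ∃ (N : ℕ) (τ : ℕ → Icc (0 : ℝ) T) (idx : Icc (0 : ℝ) T → ℕ), Monotone τ ∧
      τ 0 = ⟨0, left_mem_Icc.2 hT.le⟩ ∧ Monotone idx ∧ (∀ t, idx t ≤ N) ∧
      (∀ i ≤ N, idx (τ i) = i) ∧ (∀ t, τ (idx t) ≤ t) ∧
      (∀ s i, idx s < i → i ≤ N → s ≤ τ i) ∧ (∀ i, |v (τ (i + 1)) - v (τ i)| ≤ ε) ∧
      ∀ t, |v t - v (τ (idx t))| ≤ ε := by
  obtain ⟨δ, hδ, hvδ⟩ := Metric.uniformContinuous_iff.1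
    (CompactSpace.uniformContinuous_of_continuous hv) ε hε
  obtain ⟨N, hN⟩ := exists_nat_gt (T / δ)
  have hN0 : (0 : ℝ) < N := lt_of_le_of_lt (by positivity) hN
  set h : ℝ := T / N with hh
  have h0 : 0 < h := by positivity
  have hhδ : h < δ := by
    rw [hh, div_lt_iff₀ hN0]
    rwa [div_lt_iff₀ hδ, mul_comm] at hN
  have hNh : N * h = T := by rw [hh]; field_simp
  -- Clamping makes the nodes stationary at T beyond index N, so monotonicity and small oscillation
  -- hold for every i.
  let τ : ℕ → Icc (0 : ℝ) T := fun i => projIcc 0 T hT.le (i * h)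
  have hτ : ∀ i ≤ N, (τ i : ℝ) = i * h := by
    intro i hi
    have : (i : ℝ) * h ∈ Icc 0 T := by
      refine ⟨by positivity, ?_⟩
      rw [← hNh]
      gcongr
    simp only [τ, projIcc_of_mem hT.le this]
  let idx : Icc (0 : ℝ) T → ℕ := fun t => ⌊(t : ℝ) / h⌋₊
  have hidxN : ∀ t, idx t ≤ N := by
    intro t
    refine Nat.floor_le_of_le ?_
    rw [div_le_iff₀ h0, hNh]
    exact t.2.2
  have hle : ∀ t, (idx t : ℝ) * h ≤ t := by
    intro t
    rw [← le_div_iff₀ h0]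
    exact Nat.floor_le (div_nonneg t.2.1 h0.le)
  have hlt : ∀ t : Icc (0 : ℝ) T, (t : ℝ) < (idx t + 1) * h := by
    intro t
    rw [← div_lt_iff₀ h0]
    exact Nat.lt_floor_add_one _
  refine ⟨N, τ, idx, ?_, ?_, ?_, hidxN, ?_, ?_, ?_, ?_, ?_⟩
  · intro i j hij
    refine monotone_projIcc hT.le ?_
    gcongr
  · ext
    simpa using hτ 0 (Nat.zero_le _)
  · intro s t hst
    refine Nat.floor_le_floor ?_
    gcongr
  · intro i hi
    simp only [idx, hτ i hi]
    rw [mul_div_cancel_right₀ _ h0.ne', Nat.floor_natCast]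
  · intro t
    change (τ (idx t) : ℝ) ≤ t
    rw [hτ _ (hidxN t)]
    exact hle t
  · intro s i hsi hi
    change (s : ℝ) ≤ τ i
    rw [hτ i hi]
    refine (hlt s).le.trans ?_
    gcongr
    exact_mod_cast hsi
  · intro i
    rw [← Real.dist_eq]
    refine (hvδ ?_).le
    rw [Subtype.dist_eq, Real.dist_eq]
    refine lt_of_le_of_lt (abs_projIcc_sub_projIcc hT.le) ?_
    push_cast
    rw [add_mul, one_mul, add_sub_cancel_left, abs_of_pos h0]
    exact hhδ
  · intro t
    rw [← Real.dist_eq]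
    refine (hvδ ?_).le
    rw [Subtype.dist_eq, Real.dist_eq, hτ _ (hidxN t), abs_of_nonneg (by linarith [hle t])]
    linarith [hlt t]

end Grid

/-! ### Integral estimates for the perturbation f -/

section Perturbation

variable {E : Type*} [NormedAddCommGroup E] [NormedSpace ℝ E] {T : ℝ}

instance isFiniteMeasure_lebesgue : IsFiniteMeasure (lebesgue T) := by
  refine ⟨?_⟩
  rw [lebesgue, (MeasurableEmbedding.subtype_coe measurableSet_Icc).comap_apply, image_univ,
    Subtype.range_coe]
  exact measure_Icc_lt_top

lemma setIntegral_Ioc_sub {μ : Measure (Icc (0 : ℝ) T)} {g : Icc (0 : ℝ) T → E}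
    (hg : Integrable g μ) (t₀ : Icc (0 : ℝ) T) (h₀ : ∀ t, t₀ ≤ t) {s t : Icc (0 : ℝ) T}
    (hst : s ≤ t) :
    ∫ r in Ioc s t, g r ∂μ = (∫ r in Ioc t₀ t, g r ∂μ) - ∫ r in Ioc t₀ s, g r ∂μ := by
  rw [← Ioc_union_Ioc_eq_Ioc (h₀ s) hst, setIntegral_union (Ioc_disjoint_Ioc_of_le le_rfl)
    measurableSet_Ioc hg.integrableOn hg.integrableOn]
  abel

/-- The bound ‖f(r, x)‖ ≤ ‖f(r, 0)‖ + Lf R is why the control only has to dominate Lebesgue measure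
and the integral of ‖f(·, 0)‖. -/
lemma norm_setIntegral_comp_le {f : Icc (0 : ℝ) T → E → E} {Lf : ℝ≥0}
    (hf : ∀ t, LipschitzWith Lf (f t)) {v : Icc (0 : ℝ) T → ℝ}
    (hf0i : Integrable (fun t => f t 0) (lebesgue T))
    (hf0 : ∀ s t, s ≤ t → ∫ r in Ioc s t, ‖f r 0‖ ∂(lebesgue T) ≤ v t - v s)
    (hlv : ∀ s t, s ≤ t → (lebesgue T).real (Ioc s t) ≤ v t - v s)
    {R : ℝ} (hR : 0 ≤ R) {x : Icc (0 : ℝ) T → E} (hx : ∀ t, ‖x t‖ ≤ R)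
    {s t : Icc (0 : ℝ) T} (hst : s ≤ t) :
    ‖∫ r in Ioc s t, f r (x r) ∂(lebesgue T)‖ ≤ (1 + Lf * R) * (v t - v s) := by
  have hb : ∀ r, ‖f r (x r)‖ ≤ ‖f r 0‖ + Lf * R := by
    intro r
    have h1 : ‖f r (x r) - f r 0‖ ≤ Lf * ‖x r - 0‖ := (hf r).norm_sub_le _ _
    have h2 : ‖f r (x r)‖ ≤ ‖f r (x r) - f r 0‖ + ‖f r 0‖ := by
      simpa using norm_add_le (f r (x r) - f r 0) (f r 0)
    rw [sub_zero] at h1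
    have h3 : (Lf : ℝ) * ‖x r‖ ≤ Lf * R := by gcongr; exact hx r
    linarith
  calc ‖∫ r in Ioc s t, f r (x r) ∂(lebesgue T)‖
      ≤ ∫ r in Ioc s t, (‖f r 0‖ + Lf * R) ∂(lebesgue T) :=
        norm_integral_le_of_norm_le (hf0i.norm.add (integrable_const _)).integrableOn
          (Eventually.of_forall hb)
    _ = (∫ r in Ioc s t, ‖f r 0‖ ∂(lebesgue T)) + (lebesgue T).real (Ioc s t) * (Lf * R) := by
        rw [integral_add hf0i.norm.integrableOn (integrable_const _)]
        simp
    _ ≤ (v t - v s) + (v t - v s) * (Lf * R) := by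
        gcongr
        · exact hf0 s t hst
        · exact hlv s t hst
    _ = _ := by ring

lemma norm_setIntegral_comp_sub_le {f : Icc (0 : ℝ) T → E → E} {Lf : ℝ≥0}
    (hf : ∀ t, LipschitzWith Lf (f t)) {v : Icc (0 : ℝ) T → ℝ}
    (hlv : ∀ s t, s ≤ t → (lebesgue T).real (Ioc s t) ≤ v t - v s)
    {x y : Icc (0 : ℝ) T → E} (hx : Integrable (fun t => f t (x t)) (lebesgue T))
    (hy : Integrable (fun t => f t (y t)) (lebesgue T)) {δ : ℝ} (hδ : 0 ≤ δ)
    {s t : Icc (0 : ℝ) T} (hst : s ≤ t) (hxy : ∀ r ∈ Ioc s t, ‖x r - y r‖ ≤ δ) :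
    ‖(∫ r in Ioc s t, f r (x r) ∂(lebesgue T)) - ∫ r in Ioc s t, f r (y r) ∂(lebesgue T)‖
      ≤ Lf * δ * (v t - v s) := by
  rw [← integral_sub hx.integrableOn hy.integrableOn]
  refine (norm_setIntegral_le_of_norm_le_const (C := Lf * δ) (measure_lt_top _ _)
    fun r hr => ?_).trans ?_
  · refine ((hf r).norm_sub_le _ _).trans ?_
    gcongr
    exact hxy r hr
  · gcongr
    exact hlv s t hst

end Perturbation

/-! ### Passage to the limit in the scheme -/

section Limit

variable {E : Type*} [NormedAddCommGroup E] [InnerProductSpace ℝ E] [FiniteDimensional ℝ E]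
  {T : ℝ}

/-- Existence of a trajectory satisfying the sweeping process inequality in integrated form. All
increments are measured by the continuous increasing control `v`. -/
theorem exists_integrated_solution (hT : 0 < T) {A : Set E} (hne : A.Nonempty) (hcl : IsClosed A)
    (hA : Convex ℝ A) (hbd : Bornology.IsBounded A) {c : E → E} {L : ℝ≥0} (hL : L < 1)
    (hc : LipschitzWith L c) {a : Icc (0 : ℝ) T → E} {v : Icc (0 : ℝ) T → ℝ} (hv : Continuous v)
    (hvm : Monotone v) (hav : ∀ s t, s ≤ t → ‖a t - a s‖ ≤ v t - v s)
    {f : Icc (0 : ℝ) T → E → E} {Lf : ℝ≥0} (hf : ∀ t, LipschitzWith Lf (f t))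
    (hfi : ∀ x : Icc (0 : ℝ) T → E, Continuous x → Integrable (fun t => f t (x t)) (lebesgue T))
    (hf0 : ∀ s t, s ≤ t → ∫ r in Ioc s t, ‖f r 0‖ ∂(lebesgue T) ≤ v t - v s)
    (hlv : ∀ s t, s ≤ t → (lebesgue T).real (Ioc s t) ≤ v t - v s)
    {x₀ : E} (hx₀ : x₀ - a ⟨0, left_mem_Icc.2 hT.le⟩ - c x₀ ∈ A) :
    ∃ K : ℝ, 0 ≤ K ∧ ∃ x : Icc (0 : ℝ) T → E, Continuous x ∧
      x ⟨0, left_mem_Icc.2 hT.le⟩ = x₀ ∧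
      (∀ s t, s ≤ t → ‖x t - x s‖ ≤ K * (v t - v s)) ∧
      (∀ t, x t - a t - c (x t) ∈ A) ∧
      ∀ α ∈ A, ∀ s t, s ≤ t → ∀ (ζ : E) (ω : ℝ),
        (∀ r ∈ Icc s t, ‖x r - a r - c (x r) - ζ‖ ≤ ω) →
        -(K * ω * (v t - v s)) ≤
          inner ℝ (α - ζ) (x t - x s + ∫ r in Ioc s t, f r (x r) ∂(lebesgue T)) := by
  have hL' : (0 : ℝ) < 1 - L := by
    have : (L : ℝ) < 1 := by exact_mod_cast hL
    linarith
  set t₀ : Icc (0 : ℝ) T := ⟨0, left_mem_Icc.2 hT.le⟩ with ht₀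
  have ht₀le : ∀ t, t₀ ≤ t := fun t => t.2.1
  obtain ⟨M, hM⟩ := hbd.exists_norm_le
  have hM0 : 0 ≤ M := (norm_nonneg _).trans (hM _ hne.some_mem)
  have ha : ∀ t, ‖a t‖ ≤ ‖a t₀‖ + (v ⟨T, right_mem_Icc.2 hT.le⟩ - v t₀) := by
    intro t
    have h1 := hav t₀ t (ht₀le t)
    have h2 : v t ≤ v ⟨T, right_mem_Icc.2 hT.le⟩ := hvm t.2.2
    have h3 : ‖a t‖ ≤ ‖a t₀‖ + ‖a t - a t₀‖ := by
      simpa using norm_add_le (a t₀) (a t - a t₀)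
    linarith
  set Ma := ‖a t₀‖ + (v ⟨T, right_mem_Icc.2 hT.le⟩ - v t₀)
  have hMa0 : 0 ≤ Ma := (norm_nonneg _).trans (ha t₀)
  set R := (M + Ma + ‖c 0‖) / (1 - L) with hR
  have hR0 : 0 ≤ R := by positivity
  have hf0i := hfi (fun _ => 0) continuous_const
  set B : ℝ := 1 + Lf * R with hB
  have hB0 : 0 ≤ B := by positivity
  set K : ℝ := (2 * B + 1) / (1 - L) with hK
  have hK0 : 0 ≤ K := by positivity
  choose N τ idx hτm hτ0 hidxm hidxN hidxτ hτidx hidxlt hvτ hvidx using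
    fun n : ℕ => exists_grid hT hv (ε := 1 / ((n : ℝ) + 1)) (by positivity)
  choose X hX0 hXA hXR hXK hXvar using fun n : ℕ =>
    exists_catchingUp hne hcl hA hL hc hM (fun i => a (τ n i)) (fun i => ha _)
      (fun i => v (τ n i)) (B := B) (fun i => hav _ _ (hτm n i.le_succ))
      (fun i x => ∫ r in Ioc (τ n i) (τ n (i + 1)), f r x ∂(lebesgue T))
      (fun i x hx => norm_setIntegral_comp_le hf hf0i hf0 hlv hR0 (x := fun _ => x) (fun _ => hx)
        (hτm n i.le_succ)) (x₀ := x₀) (by rw [hτ0]; exact hx₀)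
  -- Along an ultrafilter the bounded iterates converge at all times at once, with no extraction of
  -- subsequences.
  let U : Ultrafilter ℕ := hyperfilter ℕ
  have hU : (U : Filter ℕ) ≤ atTop := Nat.hyperfilter_le_atTop
  have hε : Tendsto (fun n : ℕ => 1 / ((n : ℝ) + 1)) U (𝓝 0) :=
    tendsto_one_div_add_atTop_nhds_zero_nat.mono_left hU
  have hex : ∀ t, ∃ l, Tendsto (fun n => X n (idx n t)) U (𝓝 l) := by
    intro t
    obtain ⟨l, -, hl⟩ := (isCompact_closedBall (0 : E) R).ultrafilter_le_nhds
      (U.map fun n => X n (idx n t)) (by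
        simp only [Ultrafilter.coe_map, le_principal_iff, mem_map]
        exact Eventually.of_forall fun n => by simpa using hXR n (idx n t))
    exact ⟨l, hl⟩
  choose x hx using hex
  have hvlim : ∀ t, Tendsto (fun n => v (τ n (idx n t))) U (𝓝 (v t)) := by
    intro t
    rw [tendsto_iff_dist_tendsto_zero]
    refine squeeze_zero (fun _ => dist_nonneg) (fun n => ?_) hε
    rw [dist_comm, Real.dist_eq]
    exact hvidx n t
  -- Used for y = a and for the primitive of f(·, x(·)).
  have hlim_of_le : ∀ {y : Icc (0 : ℝ) T → E} {C : ℝ},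
      (∀ s t, s ≤ t → ‖y t - y s‖ ≤ C * (v t - v s)) → ∀ t,
      Tendsto (fun n => y (τ n (idx n t))) U (𝓝 (y t)) := by
    intro y C hy t
    rw [tendsto_iff_norm_sub_tendsto_zero]
    have h0 : Tendsto (fun n => C * (v t - v (τ n (idx n t)))) U (𝓝 0) := by
      simpa using ((tendsto_const_nhds (x := v t)).sub (hvlim t)).const_mul C
    refine squeeze_zero (fun _ => norm_nonneg _) (fun n => ?_) h0
    rw [norm_sub_rev]
    exact hy _ _ (hτidx n t)
  have hXn : ∀ n s t, s ≤ t →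
      ‖X n (idx n t) - X n (idx n s)‖ ≤ K * (v (τ n (idx n t)) - v (τ n (idx n s))) :=
    fun n s t hst => norm_sub_le_of_step_le (w := fun i => v (τ n i)) (hXK n) (hidxm n hst)
  have hxK : ∀ s t, s ≤ t → ‖x t - x s‖ ≤ K * (v t - v s) := by
    intro s t hst
    exact le_of_tendsto_of_tendsto' ((hx t).sub (hx s)).norm
      (((hvlim t).sub (hvlim s)).const_mul K) fun n => hXn n s t hst
  have hxK' : ∀ s t, ‖x t - x s‖ ≤ K * |v t - v s| := by
    intro s t
    rcases le_total s t with h | h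
    · exact (hxK s t h).trans (by gcongr; exact le_abs_self _)
    · rw [norm_sub_rev, abs_sub_comm]
      exact (hxK t s h).trans (by gcongr; exact le_abs_self _)
  have hXn' : ∀ n s t,
      ‖X n (idx n t) - X n (idx n s)‖ ≤ K * (|v t - v s| + 2 * (1 / ((n : ℝ) + 1))) := by
    have : ∀ n s t, |v (τ n (idx n t)) - v (τ n (idx n s))|
        ≤ |v t - v s| + 2 * (1 / ((n : ℝ) + 1)) := by
      intro n s t
      have h1 := hvidx n t
      have h2 := hvidx n s
      rw [abs_sub_comm] at h1
      calc |v (τ n (idx n t)) - v (τ n (idx n s))|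
          = |(v t - v s) + (v (τ n (idx n t)) - v t) + (v s - v (τ n (idx n s)))| := by
            congr 1; ring
        _ ≤ _ := by
            refine (abs_add_three _ _ _).trans ?_
            linarith
    intro n s t
    rcases le_total s t with h | h
    · refine (hXn n s t h).trans ?_
      gcongr
      exact (le_abs_self _).trans (this n s t)
    · rw [norm_sub_rev]
      refine (hXn n t s h).trans ?_
      gcongr
      rw [abs_sub_comm]
      exact (le_abs_self _).trans (this n t s)
  have hxc : Continuous x := by
    rw [continuous_iff_continuousAt]
    intro s
    rw [ContinuousAt, tendsto_iff_norm_sub_tendsto_zero]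
    have h0 : Tendsto (fun t => K * |v t - v s|) (𝓝 s) (𝓝 0) := by
      have : Continuous fun t => K * |v t - v s| := by fun_prop
      simpa using this.tendsto s
    exact squeeze_zero (fun _ => norm_nonneg _) (fun t => hxK' s t) h0
  -- The step functions are equicontinuous up to a jump error of order 1/(n + 1) (`hXn'`), so
  -- pointwise convergence on a finite net suffices.
  have hunif : ∀ η > 0, ∀ᶠ n in (U : Filter ℕ), ∀ t, ‖X n (idx n t) - x t‖ ≤ η := by
    intro η hη
    obtain ⟨κ, hκ, hKκ⟩ : ∃ κ > 0, K * κ ≤ η / 4 :=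
      ⟨η / 4 / (K + 1), by positivity, by
        rw [mul_div_assoc', div_le_iff₀ (by positivity)]
        nlinarith⟩
    obtain ⟨S, -, hS⟩ := (isCompact_univ (X := Icc (0 : ℝ) T)).elim_nhds_subcover
      (fun s => {t | |v t - v s| < κ}) (fun s _ => by
        have : Continuous fun t => |v t - v s| := by fun_prop
        exact (isOpen_lt this continuous_const).mem_nhds (by simpa using hκ))
    have h1 : ∀ᶠ n in (U : Filter ℕ), ∀ s ∈ S, ‖X n (idx n s) - x s‖ < η / 4 := by
      rw [Finset.eventually_all]
      intro s _
      have := tendsto_iff_norm_sub_tendsto_zero.1 (hx s)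
      exact this.eventually_lt_const (by positivity)
    have h2 : ∀ᶠ n : ℕ in (U : Filter ℕ), K * (2 * (1 / ((n : ℝ) + 1))) < η / 4 := by
      have : Tendsto (fun n : ℕ => K * (2 * (1 / ((n : ℝ) + 1)))) U (𝓝 0) := by
        simpa using (hε.const_mul 2).const_mul K
      exact this.eventually_lt_const (by positivity)
    filter_upwards [h1, h2] with n hn1 hn2 t
    have ht := hS (mem_univ t)
    simp only [mem_iUnion, mem_ofPred_eq, exists_prop] at ht
    obtain ⟨s, hs, hts⟩ := ht
    have h3 := hXn' n s t
    have h4 := hxK' s t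
    have h5 := hn1 s hs
    have h6 : K * |v t - v s| ≤ η / 4 := (by gcongr : K * |v t - v s| ≤ K * κ).trans hKκ
    rw [norm_sub_rev] at h4
    calc ‖X n (idx n t) - x t‖
        = ‖(X n (idx n t) - X n (idx n s)) + (X n (idx n s) - x s) + (x s - x t)‖ := by
          congr 1; abel
      _ ≤ _ := norm_add₃_le
      _ ≤ η := by rw [mul_add] at h3; linarith
  have hxR : ∀ t, ‖x t‖ ≤ R := fun t => le_of_tendsto' (hx t).norm fun n => hXR n _
  have hxA : ∀ t, x t - a t - c (x t) ∈ A := by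
    intro t
    have hat := hlim_of_le (C := 1) (fun s t hst => by simpa using hav s t hst) t
    exact hcl.mem_of_tendsto (((hx t).sub hat).sub ((hc.continuous.tendsto _).comp (hx t)))
      (Eventually.of_forall fun n => hXA n _)
  have hfx := hfi x hxc
  -- K bounds the increments of the state and B those of the perturbation; the inequality involves
  -- their sum.
  refine ⟨K + B, by positivity, x, hxc, ?_, ?_, hxA, ?_⟩
  · refine tendsto_nhds_unique (hx t₀) ?_
    have : ∀ n, X n (idx n t₀) = x₀ := by
      intro n
      rw [show t₀ = τ n 0 from (hτ0 n).symm, hidxτ n 0 (Nat.zero_le _), hX0]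
    simp only [this]
    exact tendsto_const_nhds
  · intro s t hst
    refine (hxK s t hst).trans ?_
    have := hvm hst
    gcongr
    linarith
  intro α hα s t hst ζ ω hω
  have hω0 : 0 ≤ ω := (norm_nonneg _).trans (hω s ⟨le_rfl, hst⟩)
  set y : Icc (0 : ℝ) T → E := fun t => ∫ r in Ioc t₀ t, f r (x r) ∂(lebesgue T) with hy
  have hys : ∀ s t, s ≤ t → ∫ r in Ioc s t, f r (x r) ∂(lebesgue T) = y t - y s :=
    fun s t hst => setIntegral_Ioc_sub hfx t₀ ht₀le hst
  have hyB : ∀ s t, s ≤ t → ‖y t - y s‖ ≤ B * (v t - v s) := by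
    intro s t hst
    rw [← hys s t hst]
    exact norm_setIntegral_comp_le hf hf0i hf0 hlv hR0 hxR hst
  have hylim := hlim_of_le hyB
  rw [hys s t hst]
  -- For fixed η: z at the nodes is within ω + 2η of ζ (η from the state, at most η from c), and the
  -- frozen state is within η + Kη of x on each cell.
  have key : ∀ η > 0,
      -(((ω + 2 * η) * (K + B) + ‖α - ζ‖ * (Lf * (η + K * η))) * (v t - v s))
        ≤ inner ℝ (α - ζ) (x t - x s + (y t - y s)) := by
    intro η hη
    have hev : ∀ᶠ n : ℕ in (U : Filter ℕ), 1 / ((n : ℝ) + 1) < η := hε.eventually_lt_const hη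
    refine le_of_tendsto_of_tendsto (((hvlim t).sub (hvlim s)).const_mul _).neg
      ((tendsto_const_nhds (x := α - ζ)).inner
        (((hx t).sub (hx s)).add ((hylim t).sub (hylim s)))) ?_
    filter_upwards [hunif η hη, hev] with n hn hn2
    refine inner_sum_ge (w := fun i => v (τ n i)) (z := fun i => X n i - a (τ n i) - c (X n i)) (Y := fun i => y (τ n i))
      (by positivity) (hXK n)
      (fun i => norm_setIntegral_comp_le hf hf0i hf0 hlv hR0 (x := fun _ => X n i)
        (fun _ => hXR n i) (hτm n i.le_succ))
      (fun i => hXvar n i α hα) (hidxm n hst) ?_ ?_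
    · intro i hi1 hi2
      have hiN := hi2.trans (hidxN n t)
      have h1 := hω (τ n i) ⟨hidxlt n s i hi1 hiN, (hτm n hi2).trans (hτidx n t)⟩
      have h2 := hn (τ n i)
      rw [hidxτ n i hiN] at h2
      have h3 : ‖c (x (τ n i)) - c (X n i)‖ ≤ L * ‖x (τ n i) - X n i‖ := hc.norm_sub_le _ _
      rw [norm_sub_rev (x (τ n i))] at h3
      have h4 : (L : ℝ) * ‖X n i - x (τ n i)‖ ≤ 1 * η := by
        gcongr
        linarith
      calc ‖X n i - a (τ n i) - c (X n i) - ζ‖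
          = ‖(x (τ n i) - a (τ n i) - c (x (τ n i)) - ζ) + (X n i - x (τ n i))
              + (c (x (τ n i)) - c (X n i))‖ := by congr 1; abel
        _ ≤ _ := norm_add₃_le
        _ ≤ ω + 2 * η := by linarith
    · intro i hi1 hi2
      have hiN : i + 1 ≤ N n := (Nat.succ_le_of_lt hi2).trans (hidxN n t)
      rw [← hys _ _ (hτm n i.le_succ)]
      refine norm_setIntegral_comp_sub_le hf hlv (x := fun _ => X n i)
        (hfi _ continuous_const) hfx (by positivity) (hτm n i.le_succ) fun r hr => ?_
      have h2 := hn (τ n i)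
      rw [hidxτ n i (by omega)] at h2
      have h3 := hxK (τ n i) r hr.1.le
      have h4 : v r - v (τ n i) ≤ η := by
        have h5 := hvm hr.2
        have h6 := (le_abs_self _).trans (hvτ n i)
        linarith
      have h7 : K * (v r - v (τ n i)) ≤ K * η := by gcongr
      calc ‖X n i - x r‖ = ‖(X n i - x (τ n i)) - (x r - x (τ n i))‖ := by congr 1; abel
        _ ≤ _ := norm_sub_le _ _
        _ ≤ η + K * η := by linarith
  have hlim : Tendsto (fun η : ℝ =>
      -(((ω + 2 * η) * (K + B) + ‖α - ζ‖ * (Lf * (η + K * η))) * (v t - v s))) (𝓝[>] 0)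
      (𝓝 (-((K + B) * ω * (v t - v s)))) := by
    have : Continuous fun η : ℝ =>
      -(((ω + 2 * η) * (K + B) + ‖α - ζ‖ * (Lf * (η + K * η))) * (v t - v s)) := by fun_prop
    have h := (this.tendsto 0).mono_left (nhdsWithin_le_nhds (s := Ioi 0))
    convert h using 2
    ring
  exact le_of_tendsto hlim (by filter_upwards [self_mem_nhdsWithin] with η hη using key η hη)

end Limit

instance compactIccSpace_Icc {T : ℝ} : CompactIccSpace (Icc (0 : ℝ) T) :=
  ⟨fun {_ _} => isClosed_Icc.isCompact⟩

/-! ### Domination and densities of the differential measure -/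

section Density

lemma boundedVariationOn_of_norm_sub_le {E : Type*} [NormedAddCommGroup E] {T : ℝ} (hT : 0 ≤ T) {x : Icc (0 : ℝ) T → E}
    {v : Icc (0 : ℝ) T → ℝ} (hv : Monotone v) (h : ∀ s t, s ≤ t → ‖x t - x s‖ ≤ v t - v s) :
    BoundedVariationOn x univ := by
  have hle : eVariationOn x univ ≤ eVariationOn v univ := by
    refine iSup_mono fun p => Finset.sum_le_sum fun i _ => ?_
    have hi := p.2.2.1 i.le_succ
    rw [edist_dist, edist_dist, dist_eq_norm, Real.dist_eq]
    exact ENNReal.ofReal_le_ofReal ((h _ _ hi).trans (le_abs_self _))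
  refine ne_top_of_le_ne_top ?_ hle
  refine MonotoneOn.boundedVariationOn (C := max |v ⟨0, left_mem_Icc.2 hT⟩| |v ⟨T, right_mem_Icc.2 hT⟩|)
    (hv.monotoneOn _) fun t _ => ?_
  exact abs_le_max_abs_abs (hv t.2.1) (hv t.2.2)

variable {E : Type*} [NormedAddCommGroup E] [InnerProductSpace ℝ E] [FiniteDimensional ℝ E]

lemma differentialMeasure_Ioc {T : ℝ} {x : Icc (0 : ℝ) T → E} (hx : IsBVContinuous x)
    {s t : Icc (0 : ℝ) T} (hst : s ≤ t) : differentialMeasure hx (Ioc s t) = x t - x s := by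
  have : CompleteSpace E := FiniteDimensional.complete ℝ E
  unfold differentialMeasure
  rw [BoundedVariationOn.vectorMeasure_Ioc _ hst,
    hx.continuous.continuousWithinAt.rightLim_eq, hx.continuous.continuousWithinAt.rightLim_eq]

lemma differentialMeasure_Icc {T : ℝ} {x : Icc (0 : ℝ) T → E} (hx : IsBVContinuous x)
    {s t : Icc (0 : ℝ) T} (hst : s ≤ t) : differentialMeasure hx (Icc s t) = x t - x s := by
  have : CompleteSpace E := FiniteDimensional.complete ℝ E
  unfold differentialMeasure
  rw [BoundedVariationOn.vectorMeasure_Icc _ hst,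
    hx.continuous.continuousWithinAt.rightLim_eq, hx.continuous.continuousWithinAt.leftLim_eq]

/-- A finite atomless measure which dominates the increments of `x` dominates `dx`. -/
lemma enorm_differentialMeasure_le {T : ℝ} (hT : 0 ≤ T) {x : Icc (0 : ℝ) T → E}
    (hx : IsBVContinuous x) {ν : Measure (Icc (0 : ℝ) T)} [IsFiniteMeasure ν]
    [NullSingletonClass ν] (hν : ∀ s t, s ≤ t → ‖x t - x s‖ₑ ≤ ν (Ioc s t))
    (D : Set (Icc (0 : ℝ) T)) :
    ‖differentialMeasure hx D‖ₑ ≤ ν D := by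
  have : CompleteSpace E := FiniteDimensional.complete ℝ E
  have : Nonempty (Icc (0 : ℝ) T) := ⟨⟨0, left_mem_Icc.2 hT⟩⟩
  have hgen : (inferInstance : MeasurableSpace (Icc (0 : ℝ) T)) =
      MeasurableSpace.generateFrom {s | ∃ u v, u ≤ v ∧ s = Ioc u v} := by
    rw [BorelSpace.measurable_eq (α := Icc (0 : ℝ) T), borel_eq_generateFrom_Ioc_le]
    simp only [eq_comm]
  obtain ⟨m, hm, hmν⟩ := VectorMeasure.exists_extension_of_isSetSemiring_of_le_measure_of_generateFrom
    (μ := ν) (m := AddContent.onIoc x) IsSetSemiring.Ioc (by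
      rintro s ⟨u, v, huv, rfl⟩
      rw [AddContent.onIoc_apply huv]
      exact hν u v huv) hgen
  have hIoc : ∀ s t, s ≤ t → m (Ioc s t) = x t - x s := by
    intro s t hst
    rw [hm _ ⟨s, t, hst, rfl⟩, AddContent.onIoc_apply hst]
  have heq : m = differentialMeasure hx := by
    refine VectorMeasure.ext_of_generateFrom _ ?_ hgen IsSetSemiring.Ioc.isPiSystem ?_
    · rintro s ⟨u, v, huv, rfl⟩
      rw [hIoc u v huv, differentialMeasure_Ioc hx huv]
    · have hle : (⟨0, left_mem_Icc.2 hT⟩ : Icc (0 : ℝ) T) ≤ ⟨T, right_mem_Icc.2 hT⟩ := hT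
      have huniv : (univ : Set (Icc (0 : ℝ) T)) =
          Icc ⟨0, left_mem_Icc.2 hT⟩ ⟨T, right_mem_Icc.2 hT⟩ := by
        ext t
        simpa using ⟨t.2.1, t.2.2⟩
      -- The whole space is not a half-open interval: the left endpoint is missing, and it is null
      -- because ν has no atoms.
      rw [huniv, differentialMeasure_Icc hx hle, ← Icc_union_Ioc_eq_Icc le_rfl hle,
        VectorMeasure.of_union (by simp) measurableSet_Icc measurableSet_Ioc, hIoc _ _ hle, Icc_self]
      have h0 := hmν {⟨0, left_mem_Icc.2 hT⟩}
      rw [measure_singleton, nonpos_iff_eq_zero, enorm_eq_zero] at h0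
      rw [h0, zero_add]
  rw [← heq]
  exact hmν D

/-- Radon-Nikodym theorem for vector measures with values in a finite-dimensional inner product
space. -/
lemma exists_isDensity {α : Type*} [MeasurableSpace α] {m : VectorMeasure α E} {ν : Measure α}
    [IsFiniteMeasure ν] (h : VectorMeasure.AbsolutelyContinuous m ν.toENNRealVectorMeasure) :
    ∃ g, IsDensity m ν g := by
  have : CompleteSpace E := FiniteDimensional.complete ℝ E
  let b := stdOrthonormalBasis ℝ E
  let mi : Fin (Module.finrank ℝ E) → SignedMeasure α := fun i =>
    m.mapRange (innerSL ℝ (b i)).toLinearMap.toAddMonoidHom (innerSL ℝ (b i)).continuous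
  have hmi : ∀ i D, mi i D = inner ℝ (b i) (m D) := fun i D => rfl
  have hac : ∀ i, VectorMeasure.AbsolutelyContinuous (mi i) ν.toENNRealVectorMeasure := by
    intro i D hD
    rw [hmi, h hD, inner_zero_right]
  have hint : ∀ i, Integrable ((mi i).rnDeriv ν) ν := fun i => SignedMeasure.integrable_rnDeriv _ _
  refine ⟨fun t => ∑ i, (mi i).rnDeriv ν t • b i,
    integrable_finsetSum _ fun i _ => (hint i).smul_const _, fun D hD => ?_⟩
  rw [integral_finsetSum _ fun i _ => ((hint i).smul_const _).integrableOn]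
  rw [← b.sum_repr' (m D)]
  refine Finset.sum_congr rfl fun i _ => ?_
  rw [integral_smul_const, ← hmi, ← withDensityᵥ_apply (hint i) hD,
    SignedMeasure.withDensityᵥ_rnDeriv_eq _ _ (hac i)]

end Density

/-! ### Differentiation of integrals on [0, T] -/

section LebesguePoints

lemma closedBall_eq_Icc_projIcc {T : ℝ} (hT : 0 ≤ T) (t : Icc (0 : ℝ) T) {r : ℝ} (hr : 0 ≤ r) :
    Metric.closedBall t r = Icc (projIcc 0 T hT (t - r)) (projIcc 0 T hT (t + r)) := by
  ext s
  obtain ⟨t, ht0, htT⟩ := t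
  obtain ⟨s, hs0, hsT⟩ := s
  rw [Metric.mem_closedBall, Subtype.dist_eq, Real.dist_eq, abs_le, mem_Icc, ← Subtype.coe_le_coe,
    ← Subtype.coe_le_coe, coe_projIcc, coe_projIcc, max_le_iff, min_le_iff, le_max_iff, le_min_iff]
  constructor
  · rintro ⟨h1, h2⟩
    exact ⟨⟨hs0, Or.inr (by linarith)⟩, Or.inr ⟨hsT, by linarith⟩⟩
  · rintro ⟨⟨-, h1⟩, h2⟩
    dsimp only at h1 h2
    constructor
    · rcases h1 with h1 | h1 <;> linarith
    · rcases h2 with h2 | ⟨-, h2⟩ <;> linarith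

variable {E : Type*} [NormedAddCommGroup E] [NormedSpace ℝ E] [CompleteSpace E] {T : ℝ}

/-- ν need not be doubling, so the measure is pushed forward to ℝ and differentiated along the
Besicovitch family of centred balls. -/
lemma ae_tendsto_setAverage_closedBall {ν : Measure (Icc (0 : ℝ) T)} [IsFiniteMeasure ν]
    {h : Icc (0 : ℝ) T → E} (hh : Integrable h ν) :
    ∀ᵐ t ∂ν, Tendsto (fun r => ⨍ s in Metric.closedBall t r, h s ∂ν) (𝓝[>] 0) (𝓝 (h t)) := by
  let e : Icc (0 : ℝ) T → ℝ := Subtype.val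
  have he : MeasurableEmbedding e := MeasurableEmbedding.subtype_coe measurableSet_Icc
  let h' : ℝ → E := Function.extend e h 0
  have hext : ∀ t, h' (e t) = h t := fun t => Subtype.val_injective.extend_apply h 0 t
  have hcomp : h' ∘ e = h := funext hext
  have hint : Integrable h' (ν.map e) := by
    rw [he.integrable_map_iff, hcomp]
    exact hh
  have hae := he.ae_map_iff.1
    ((Besicovitch.vitaliFamily (ν.map e)).ae_tendsto_average hint.locallyIntegrable)
  filter_upwards [hae] with t ht
  have ht2 := ht.comp (Besicovitch.tendsto_filterAt (ν.map e) (e t))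
  rw [hext] at ht2
  refine ht2.congr fun r => ?_
  simp only [Function.comp_apply]
  rw [setAverage_eq, setAverage_eq, he.setIntegral_map, measureReal_def, he.map_apply,
    ← measureReal_def]
  simp only [hext]
  rfl

end LebesguePoints

/-! ### From integrated to pointwise inequalities -/

section Variational

variable {E : Type*} [NormedAddCommGroup E] [InnerProductSpace ℝ E] [CompleteSpace E] {T : ℝ}

/-- An integrated variational inequality with a small error holds pointwise for the density. -/
lemma ae_inner_nonneg (hT : 0 ≤ T) {ν : Measure (Icc (0 : ℝ) T)} [IsFiniteMeasure ν]
    [NullSingletonClass ν] {h : Icc (0 : ℝ) T → E} (hh : Integrable h ν) {A : Set E}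
    {z : Icc (0 : ℝ) T → E} (hz : Continuous z) {K : ℝ} (hK : 0 ≤ K)
    (hvar : ∀ α ∈ A, ∀ s t, s ≤ t → ∀ (ζ : E) (ω : ℝ), (∀ r ∈ Icc s t, ‖z r - ζ‖ ≤ ω) →
      -(K * ω * ν.real (Ioc s t)) ≤ inner ℝ (α - ζ) (∫ r in Ioc s t, h r ∂ν)) :
    ∀ᵐ t ∂ν, ∀ α ∈ A, 0 ≤ inner ℝ (α - z t) (h t) := by
  -- The exceptional set depends only on h, so one null set serves all α.
  filter_upwards [ae_tendsto_setAverage_closedBall hh] with t ht α hα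
  have hlim := (tendsto_const_nhds (x := α - z t)).inner ht (𝕜 := ℝ)
  have key : ∀ ε > 0, -(K * ε) ≤ inner ℝ (α - z t) (h t) := by
    intro ε hε
    refine ge_of_tendsto hlim ?_
    obtain ⟨δ, hδ, hzδ⟩ := Metric.continuous_iff.1 hz t ε hε
    filter_upwards [Ioo_mem_nhdsGT hδ] with r hr
    rw [setAverage_eq, inner_smul_right]
    have hle : projIcc 0 T hT (t - r) ≤ projIcc 0 T hT (t + r) :=
      monotone_projIcc hT (by linarith [hr.1])
    have hb := closedBall_eq_Icc_projIcc hT t hr.1.le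
    have h1 := hvar α hα _ _ hle (z t) ε (by
      intro s hs
      rw [← hb, Metric.mem_closedBall] at hs
      rw [← dist_eq_norm]
      exact (hzδ s (hs.trans_lt hr.2)).le)
    rw [hb, measureReal_congr Ioc_ae_eq_Icc.symm, integral_Icc_eq_integral_Ioc]
    set n := ν.real (Ioc (projIcc 0 T hT (t - r)) (projIcc 0 T hT (t + r)))
    have hn : 0 ≤ n := measureReal_nonneg
    have h2 := mul_le_mul_of_nonneg_left h1 (inv_nonneg.2 hn)
    refine le_trans ?_ h2
    -- Holds for n = 0 as well, since 0⁻¹ = 0; null balls need no separate treatment.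
    have h3 : n⁻¹ * n ≤ 1 := inv_mul_le_one
    have h4 : K * ε * (n⁻¹ * n) ≤ K * ε * 1 := by gcongr
    linarith
  have hlim2 : Tendsto (fun ε : ℝ => -(K * ε)) (𝓝[>] 0) (𝓝 0) := by
    have : Continuous fun ε : ℝ => -(K * ε) := by fun_prop
    simpa using (this.tendsto 0).mono_left (nhdsWithin_le_nhds (s := Ioi 0))
  exact le_of_tendsto hlim2 (by filter_upwards [self_mem_nhdsWithin] with ε hε using key ε hε)

end Variational

/-! ### Measurability and integrability of t ↦ f(t, x(t)) -/

section Superposition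

variable {E : Type*} [NormedAddCommGroup E] {T : ℝ}

lemma nullSingletonClass_lebesgue : NullSingletonClass (lebesgue T) := by
  refine ⟨fun t => ?_⟩
  rw [lebesgue, (MeasurableEmbedding.subtype_coe measurableSet_Icc).comap_apply, image_singleton]
  exact measure_singleton _

/-- Superposition of a function of two variables, continuous in the second one and measurable in
the first one, with a measurable function is measurable. -/
lemma aestronglyMeasurable_superposition {α β γ : Type*} [MeasurableSpace α] {μ : Measure α}
    [TopologicalSpace β] [TopologicalSpace γ] [TopologicalSpace.PseudoMetrizableSpace γ]
    {f : α → β → γ} (hm : ∀ x, AEStronglyMeasurable (fun t => f t x) μ)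
    (hc : ∀ᵐ t ∂μ, Continuous (f t)) {x : α → β} (hx : StronglyMeasurable x) :
    AEStronglyMeasurable (fun t => f t (x t)) μ := by
  have hs : ∀ s : SimpleFunc α β, AEStronglyMeasurable (fun t => f t (s t)) μ := by
    intro s
    have hcover : (⋃ y : s.range, s ⁻¹' {(y : β)}) = univ := by
      refine eq_univ_of_forall fun t => mem_iUnion.2 ⟨⟨s t, s.mem_range_self t⟩, rfl⟩
    rw [← Measure.restrict_univ (μ := μ), ← hcover, aestronglyMeasurable_iUnion_iff]
    rintro ⟨y, hy⟩
    refine (hm y).restrict.congr ?_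
    filter_upwards [ae_restrict_mem (s.measurableSet_preimage {y})] with t ht
    rw [show s t = y from ht]
  refine aestronglyMeasurable_of_tendsto_ae atTop (fun n => hs (hx.approx n)) ?_
  filter_upwards [hc] with t ht
  exact (ht.tendsto _).comp (hx.tendsto_approx t)

lemma integrable_superposition [InnerProductSpace ℝ E] [FiniteDimensional ℝ E]
    {f : Icc (0 : ℝ) T → E → E} (hf : IsCaratheodory f)
    {x : Icc (0 : ℝ) T → E} (hx : Continuous x) :
    Integrable (fun t => f t (x t)) (lebesgue T) := by
  obtain ⟨R, hR⟩ := (isCompact_range hx).isBounded.exists_norm_le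
  obtain ⟨m, hm, hfm⟩ := hf.locally_bounded R
  refine hm.mono' (aestronglyMeasurable_superposition hf.measurable hf.continuous
    hx.stronglyMeasurable) ?_
  filter_upwards [hfm] with t ht
  exact ht _ (hR _ (mem_range_self t))

end Superposition

/-! ### The control measure -/

section Control

variable {E : Type*} [NormedAddCommGroup E] {T : ℝ}

/-- On the line this is the primitive of 1 against the pushed-forward measure, which inherits the
absence of atoms. -/
lemma continuous_measureReal_Ioc {ν : Measure (Icc (0 : ℝ) T)} [IsFiniteMeasure ν]
    [NullSingletonClass ν] (t₀ : Icc (0 : ℝ) T) (h₀ : ∀ t, t₀ ≤ t) :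
    Continuous fun t => ν.real (Ioc t₀ t) := by
  let e : Icc (0 : ℝ) T → ℝ := Subtype.val
  have he : MeasurableEmbedding e := MeasurableEmbedding.subtype_coe measurableSet_Icc
  have hna : NullSingletonClass (ν.map e) := by
    refine ⟨fun r => ?_⟩
    rw [he.map_apply]
    exact (subsingleton_singleton.preimage Subtype.val_injective).measure_zero ν
  have hc := intervalIntegral.continuous_primitive (μ := ν.map e) (f := fun _ => (1 : ℝ))
    (fun a b => intervalIntegrable_const) t₀
  refine (hc.comp continuous_subtype_val).congr fun t => ?_
  have ht : (t₀ : ℝ) ≤ t := h₀ t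
  simp only [Function.comp_apply]
  rw [intervalIntegral.integral_of_le ht, setIntegral_const, smul_eq_mul, mul_one,
    measureReal_def, he.map_apply, ← measureReal_def]
  rfl

lemma measureReal_Ioc_sub {ν : Measure (Icc (0 : ℝ) T)} [IsFiniteMeasure ν]
    (t₀ : Icc (0 : ℝ) T) (h₀ : ∀ t, t₀ ≤ t) {s t : Icc (0 : ℝ) T} (hst : s ≤ t) :
    ν.real (Ioc t₀ t) - ν.real (Ioc t₀ s) = ν.real (Ioc s t) := by
  rw [← Ioc_union_Ioc_eq_Ioc (h₀ s) hst, measureReal_union (Ioc_disjoint_Ioc_of_le le_rfl)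
    measurableSet_Ioc]
  ring

/-- The variation measure of a BV-continuous function is finite, atomless and dominates the
increments of the function. -/
lemma exists_variation_measure [InnerProductSpace ℝ E] [FiniteDimensional ℝ E] (hT : 0 ≤ T)
    {a : Icc (0 : ℝ) T → E} (ha : IsBVContinuous a) :
    ∃ μ : Measure (Icc (0 : ℝ) T), IsFiniteMeasure μ ∧ NullSingletonClass μ ∧
      ∀ s t, s ≤ t → ‖a t - a s‖ ≤ μ.real (Ioc s t) := by
  have : CompleteSpace E := FiniteDimensional.complete ℝ E
  let t₀ : Icc (0 : ℝ) T := ⟨0, left_mem_Icc.2 hT⟩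
  have hr : a.rightLim = a := funext fun t => ha.continuous.continuousWithinAt.rightLim_eq
  have hbv := ha.boundedVariation
  -- As a is continuous, its right-limit version is a itself, so F is the variation function of a.
  let F := hbv.stieltjesFunctionRightLim t₀
  have hF : ∀ t, F t = variationOnFromTo a univ t₀ t := by
    intro t
    simp only [F, BoundedVariationOn.stieltjesFunctionRightLim_apply, hr]
  have hF' : (F : Icc (0 : ℝ) T → ℝ) = variationOnFromTo a univ t₀ := funext hF
  refine ⟨F.measure, ?_, ⟨fun t => ?_⟩, fun s t hst => ?_⟩
  · refine F.isFiniteMeasure_of_forall_abs_le (C := (eVariationOn a univ).toReal) fun t => ?_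
    rw [hF]
    exact variationOnFromTo.abs_le_eVariationOn hbv
  · rw [StieltjesFunction.measure_singleton, hF', variationOnFromTo.leftLim_eq hbv,
      ha.continuous.continuousWithinAt.leftLim_eq]
    simp
  · rw [measureReal_def, StieltjesFunction.measure_Ioc, hF, hF,
      ENNReal.toReal_ofReal (sub_nonneg.2 (by simpa only [hF] using F.mono hst)),
      variationOnFromTo.sub_right hbv.locallyBoundedVariationOn (mem_univ _) (mem_univ _)
        (mem_univ _), variationOnFromTo.eq_of_le _ _ hst, ← dist_eq_norm, dist_edist]
    refine ENNReal.toReal_mono ?_ ?_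
    · exact ne_top_of_le_ne_top hbv (eVariationOn.mono _ (subset_univ _))
    · exact eVariationOn.edist_le _ ⟨mem_univ _, hst, le_rfl⟩ ⟨mem_univ _, le_rfl, hst⟩

/-- A finite atomless measure controlling the increments of `a`, the integrals of `g` and Lebesgue
measure. -/
lemma exists_control_measure [InnerProductSpace ℝ E] [FiniteDimensional ℝ E] (hT : 0 ≤ T)
    {a : Icc (0 : ℝ) T → E} (ha : IsBVContinuous a)
    {g : Icc (0 : ℝ) T → E} (hg : Integrable g (lebesgue T)) :
    ∃ ν : Measure (Icc (0 : ℝ) T), IsFiniteMeasure ν ∧ NullSingletonClass ν ∧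
      lebesgue T ≤ ν ∧ (∀ s t, s ≤ t → ‖a t - a s‖ ≤ ν.real (Ioc s t)) ∧
      ∀ s t, ∫ r in Ioc s t, ‖g r‖ ∂(lebesgue T) ≤ ν.real (Ioc s t) := by
  obtain ⟨μ, hμf, hμ0, hμ⟩ := exists_variation_measure hT ha
  have hl0 := nullSingletonClass_lebesgue (T := T)
  set ρ := (lebesgue T).withDensity fun t => ‖g t‖ₑ with hρ
  have hρf : IsFiniteMeasure ρ := isFiniteMeasure_withDensity hg.2.ne
  have hle1 : lebesgue T ≤ lebesgue T + ρ + μ := by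
    rw [add_assoc]; exact Measure.le_add_right le_rfl
  have hle2 : ρ ≤ lebesgue T + ρ + μ :=
    Measure.le_add_right (Measure.le_add_left le_rfl)
  have hle3 : μ ≤ lebesgue T + ρ + μ := Measure.le_add_left le_rfl
  refine ⟨lebesgue T + ρ + μ, inferInstance, ⟨fun t => ?_⟩, hle1, fun s t hst => ?_, fun s t => ?_⟩
  · have : ρ {t} = 0 := withDensity_absolutelyContinuous _ _ (measure_singleton t)
    simp [this]
  · exact (hμ s t hst).trans (ENNReal.toReal_mono (measure_ne_top _ _) (hle3 _))
  · rw [integral_norm_eq_lintegral_enorm hg.1.restrict, ← withDensity_apply _ measurableSet_Ioc]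
    exact ENNReal.toReal_mono (measure_ne_top _ _) (hle2 _)

end Control

/-! ### Assembling the solution -/

section Existence

variable {E : Type*} [NormedAddCommGroup E] [InnerProductSpace ℝ E] [FiniteDimensional ℝ E]
  {T : ℝ}

/-- The control measure also serves as the reference measure ν of the solution: increments of x are
at most K times ν of the interval, which gives dx ≪ ν and hence a density. -/
theorem exists_isSolution (hT : 0 < T) {A : Set E} (hne : A.Nonempty) (hcl : IsClosed A)
    (hA : Convex ℝ A) (hbd : Bornology.IsBounded A) {a : Icc (0 : ℝ) T → E}
    (ha : IsBVContinuous a) {c : E → E} {L : ℝ≥0} (hL : L < 1) (hc : LipschitzWith L c)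
    {f : Icc (0 : ℝ) T → E → E} (hf : IsCaratheodory f) {Lf : ℝ≥0}
    (hfL : ∀ t, LipschitzWith Lf (f t)) {x₀ : E}
    (hx₀ : x₀ ∈ movingSet A (a ⟨0, left_mem_Icc.2 hT.le⟩) (c x₀)) :
    ∃ x : Icc (0 : ℝ) T → E, IsSolution A a c f x ∧ x ⟨0, left_mem_Icc.2 hT.le⟩ = x₀ := by
  have : CompleteSpace E := FiniteDimensional.complete ℝ E
  have hfi : ∀ x : Icc (0 : ℝ) T → E, Continuous x →
      Integrable (fun t => f t (x t)) (lebesgue T) := fun x hx => integrable_superposition hf hx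
  obtain ⟨ν, hνf, hν0, hlν, haν, hgν⟩ := exists_control_measure hT.le ha (hfi (fun _ => 0) continuous_const)
  have h₀ : ∀ t : Icc (0 : ℝ) T, ⟨0, left_mem_Icc.2 hT.le⟩ ≤ t := fun t => t.2.1
  set v : Icc (0 : ℝ) T → ℝ := fun t => ν.real (Ioc ⟨0, left_mem_Icc.2 hT.le⟩ t) with hv
  have hvsub : ∀ s t, s ≤ t → v t - v s = ν.real (Ioc s t) :=
    fun s t hst => measureReal_Ioc_sub _ h₀ hst
  have hvm : Monotone v := fun s t hst => measureReal_mono (Ioc_subset_Ioc_right hst)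
  obtain ⟨K, hK, x, hxc, hx0, hxK, hxA, hxvar⟩ :=
    exists_integrated_solution hT hne hcl hA hbd hL hc (v := v)
      (continuous_measureReal_Ioc _ h₀) hvm
      (fun s t hst => by rw [hvsub s t hst]; exact haν s t hst) hfL hfi
      (fun s t hst => by rw [hvsub s t hst]; exact hgν s t)
      (fun s t hst => by
        rw [hvsub s t hst]; exact ENNReal.toReal_mono (measure_ne_top _ _) (hlν _))
      (mem_movingSet.1 hx₀)
  have hx : IsBVContinuous x := ⟨hxc, boundedVariationOn_of_norm_sub_le hT.le (v := fun t => K * v t)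
    (hvm.const_mul hK) fun s t hst => by rw [← mul_sub]; exact hxK s t hst⟩
  have hac : VectorMeasure.AbsolutelyContinuous (differentialMeasure hx) ν.toENNRealVectorMeasure := by
    have hKν : NullSingletonClass (K.toNNReal • ν) := ⟨fun t => by simp⟩
    have hb := enorm_differentialMeasure_le hT.le hx (ν := K.toNNReal • ν) (by
      intro s t hst
      have h1 := hxK s t hst
      rw [hvsub s t hst] at h1
      rw [← ofReal_norm, Measure.smul_apply, ENNReal.smul_def, smul_eq_mul,
        ← ENNReal.ofReal_toReal (measure_ne_top ν (Ioc s t))]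
      refine (ENNReal.ofReal_le_ofReal h1).trans ?_
      rw [ENNReal.ofReal_mul hK]
      rfl)
    refine VectorMeasure.AbsolutelyContinuous.mk fun D hD h => ?_
    rw [Measure.toENNRealVectorMeasure_apply_measurable hD] at h
    have := hb D
    rwa [Measure.smul_apply, h, smul_zero, nonpos_iff_eq_zero, enorm_eq_zero] at this
  obtain ⟨g, hg⟩ := exists_isDensity hac
  have hlac := Measure.absolutelyContinuous_of_le hlν
  refine ⟨x, ⟨hx, ν, hνf, hac, hlac, g, hg, ?_⟩, hx0⟩
  have hθ : Integrable (fun t => ((lebesgue T).rnDeriv ν t).toReal • f t (x t)) ν :=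
    (integrable_rnDeriv_smul_iff hlac).2 (hfi x hxc)
  -- The ν-integral of g + (dt/dν) f over (s, t] is x(t) - x(s) + ∫ f dt, the vector of the
  -- integrated inequality.
  have hae := ae_inner_nonneg hT.le (hg.integrable.add hθ) (A := A)
    (z := fun t => x t - a t - c (x t)) ((hxc.sub ha.continuous).sub (hc.continuous.comp hxc)) hK
    (by
      intro α hα s t hst ζ ω hω
      have h1 := hxvar α hα s t hst ζ ω hω
      rw [hvsub s t hst] at h1
      rw [integral_add' hg.integrable.integrableOn hθ.integrableOn,
        ← hg.eq_setIntegral _ measurableSet_Ioc, differentialMeasure_Ioc hx hst,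
        setIntegral_rnDeriv_smul hlac measurableSet_Ioc]
      exact h1)
  filter_upwards [hae] with t ht
  rw [add_singleton]
  refine ⟨-(g t + ((lebesgue T).rnDeriv ν t).toReal • f t (x t)),
    ⟨mem_movingSet.2 (hxA t), fun y hy => ?_⟩, by simp⟩
  have h1 := ht _ (mem_movingSet.1 hy)
  rw [inner_neg_left, real_inner_comm]
  rw [show y - a t - c (x t) - (x t - a t - c (x t)) = y - x t by abel] at h1
  exact neg_nonpos.2 h1

end Existence

end SweepingProcess

theorem theorem1 {E : Type*} [NormedAddCommGroup E] [InnerProductSpace ℝ E]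
    [FiniteDimensional ℝ E] {T : ℝ} (hT : 0 < T)
    (A : Set E) (hA_nonempty : A.Nonempty) (hA_closed : IsClosed A) (hA_convex : Convex ℝ A)
    (hA_bounded : Bornology.IsBounded A)
    (a : Icc (0 : ℝ) T → E) (ha : SweepingProcess.IsBVContinuous a)
    (c : E → E) (L₂ : ℝ≥0) (hL₂ : L₂ < 1) (hc : LipschitzWith L₂ c)
    (f : Icc (0 : ℝ) T → E → E) (hf : SweepingProcess.IsCaratheodory f)
    (hf_lip : ∃ L : ℝ≥0, ∀ t, LipschitzWith L (f t)) :
    ∃ V : E → E,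
      (∀ q v : E, v = V q ↔
        SweepingProcess.IsProj q
          (SweepingProcess.movingSet A (a ⟨0, left_mem_Icc.2 hT.le⟩) (c v)) v) ∧
      (∀ q : E, ∃ x : Icc (0 : ℝ) T → E, SweepingProcess.IsSolution A a c f x ∧
        x ⟨0, left_mem_Icc.2 hT.le⟩ = V q) ∧
      (∀ q : E, q ∈ SweepingProcess.movingSet A (a ⟨0, left_mem_Icc.2 hT.le⟩) (c q) →
        ∃ x : Icc (0 : ℝ) T → E, SweepingProcess.IsSolution A a c f x ∧
          x ⟨0, left_mem_Icc.2 hT.le⟩ = q) := by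
  have : CompleteSpace E := FiniteDimensional.complete ℝ E
  obtain ⟨L, hL⟩ := hf_lip
  choose V hV hVu using SweepingProcess.existsUnique_isProj hA_nonempty hA_closed hA_convex hL₂ hc
    (a ⟨0, left_mem_Icc.2 hT.le⟩)
  refine ⟨V, fun q v => ⟨?_, fun h => hVu q v h⟩, fun q => ?_, fun q hq => ?_⟩
  · rintro rfl
    exact hV q
  · exact SweepingProcess.exists_isSolution hT hA_nonempty hA_closed hA_convex hA_bounded ha hL₂ hc
      hf hL (hV q).1
  · exact SweepingProcess.exists_isSolution hT hA_nonempty hA_closed hA_convex hA_bounded ha hL₂ hc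
      hf hL hq
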